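/- Let $d\ge 1$ be an integer, let $s\in(0,d/2)$ and let $2<q<\frac{2d}{d-2s}$. For $u$ in the (inhomogeneous) Sobolev space $H^s(\mathbb{R}^d)$ of complex-valued functions, let $$\|u\|_{H^s}=\|(1-\Delta)^{s/2}u\|_{L^2(\mathbb{R}^d)}.$$ Then the supremum $$\mathcal{S}:=\sup\Big\{\int_{\mathbb{R}^d}|u|^q \ :\ u\in H^s(\mathbb{R}^d),\ \|u\|_{H^s}=1\Big\}$$ is finite and it is attained: there exists $u\in H^s(\mathbb{R}^d)$ with $\|u\|_{H^s}=1$ and $\int_{\mathbb{R}^d}|u|^q=\mathcal{S}$. -/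

import Mathlib

open MeasureTheory FourierTransform TemperedDistribution
open scoped ENNReal SchwartzMap

noncomputable section

namespace GNS

/-- `ℝ^d` with its Euclidean norm. -/
abbrev Space (d : ℕ) : Type := EuclideanSpace ℝ (Fin d)

/-- Complex-valued square-integrable functions on `ℝ^d` (modulo a.e. equality). -/
abbrev L2 (d : ℕ) : Type := Lp (α := Space d) ℂ 2

/-- Membership in the inhomogeneous Sobolev space `H^s(ℝ^d)`.
For `s ≥ 0` this space consists of `L²` functions. -/
def MemHs {d : ℕ} (s : ℝ) (u : L2 d) : Prop :=
  MemSobolev s 2 (u : 𝓢'(Space d, ℂ))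

/-- The norm `‖u‖_{H^s} = ‖(1 - Δ)^{s/2} u‖_{L²}`, computed by Plancherel on the Fourier side.
Since `𝓕 u ξ = ∫ e^{-2πi x·ξ} u x dx`, the operator `1 - Δ` has the symbol `1 + (2π|ξ|)²`.
The norm is `∞` when `u` is not in `H^s`. -/
def hsNorm {d : ℕ} (s : ℝ) (u : L2 d) : ℝ≥0∞ :=
  eLpNorm (fun ξ : Space d =>
    (1 + (2 * Real.pi * ‖ξ‖) ^ 2) ^ (s / 2) • (𝓕 u : L2 d) ξ) 2 volume

/-- The set of `u ∈ H^s(ℝ^d)` with `‖u‖_{H^s} = 1`. -/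
def hsSphere (d : ℕ) (s : ℝ) : Set (L2 d) :=
  {u | MemHs s u ∧ hsNorm s u = 1}

/-- The energy `∫ |u|^q` over `ℝ^d`, with values in `[0, ∞]`. -/
def lqEnergy {d : ℕ} (q : ℝ) (u : L2 d) : ℝ≥0∞ :=
  ∫⁻ x : Space d, ‖u x‖ₑ ^ q

/-- The supremum of `∫ |u|^q` over the unit sphere of `H^s(ℝ^d)`, with values in `[0, ∞]`. -/
def bestConst (d : ℕ) (s q : ℝ) : ℝ≥0∞ :=
  sSup (lqEnergy q '' hsSphere d s)

end GNS

end

open Filter Topology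

noncomputable section

namespace GNS

variable {d : ℕ} {s q : ℝ}

/-! Writing `u = besselMap f` turns the unit sphere of `H^s` into the unit sphere of `L²`, and turns
translation of `u` into modulation of `f` by a character. A multiplier supported in a ball of
frequencies has a representative whose value at each point is the inner product of `f` with an `L²`
function (`exists_evalAt_eq_inner`). Such a piece is therefore bounded pointwise, and its values
pass to the limit under weak convergence.

Finiteness: a dyadic ring at frequency `2^k` is estimated in `L^q` by interpolating between `L²` and
`L^∞`. Subcriticality of `q` makes these bounds geometric in `k`, so they sum, and the high
frequencies are uniformly small in `L^q`.

Attainment: since `q` lies strictly between `2` and the critical exponent, the only loss of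
compactness to undo is translation. If the energy of `u` is bounded below, so is the `L^q` norm of a
low-frequency part. As `q > 2`, this part must be large at some point, which can be moved to the
origin (`exists_nonvanishing`). A maximizing sequence, suitably translated, then has a nonzero weak
limit `F`, and a subsequence of the functions converges a.e. (`WeakTendsto.exists_ae_tendsto`). A
one-sided Brezis–Lieb splitting gives `S ≤ S (t^q + (1 - t²)^{q/2})` with `t = ‖F‖` and `S` the
supremum. Since `0 < S < ∞` and `q > 2`, this excludes `0 < t < 1`. Hence `t = 1`, no energy
escapes, and `F` gives an optimizer. -/

/-! ### The inverse Fourier transform on `L¹ ∩ L²` -/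

/-- On `L¹ ∩ L²` the `L²` inverse Fourier transform is given by the Fourier integral. -/
theorem fourierInv_toLp_ae {g : Space d → ℂ} (h1 : Integrable g) (h2 : MemLp g 2) :
    (𝓕⁻ (h2.toLp g) : L2 d) =ᵐ[volume] 𝓕⁻ g := by
  have hcont : Continuous (𝓕⁻ g : Space d → ℂ) := by
    rw [← Real.Lp.fourierTransformInv_toLp (memLp_one_iff_integrable.2 h1)]
    exact (Real.Lp.fourierTransformInv _).continuous
  -- Both sides are locally integrable, so it suffices to pair them with smooth compactly supported
  -- functions. There the `L²` transform is the distributional one, and Fubini moves the transform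
  -- from the test function back to `g`.
  refine ae_eq_of_integral_contDiff_smul_eq
    ((Lp.memLp (𝓕⁻ (h2.toLp g) : L2 d)).locallyIntegrable (by norm_num))
    hcont.locallyIntegrable fun φ φ_smooth φ_cpt => ?_
  have hφ₁ : HasCompactSupport (Complex.ofRealCLM ∘ φ) := φ_cpt.comp_left rfl
  have hφ₂ : ContDiff ℝ ((⊤ : ℕ∞) : WithTop ℕ∞) (Complex.ofRealCLM ∘ φ) := by fun_prop
  set ψ : 𝓢(Space d, ℂ) := hφ₁.toSchwartzMap hφ₂ with hψ
  have hval : ∀ x, ψ x = (φ x : ℂ) := fun x => rfl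
  have e1 : ∫ x, φ x • (𝓕⁻ (h2.toLp g) : L2 d) x
      = ((𝓕⁻ (h2.toLp g) : L2 d) : 𝓢'(Space d, ℂ)) ψ := by
    rw [Lp.toTemperedDistribution_apply]
    simp [hval]
  have e2 : ((𝓕⁻ (h2.toLp g) : L2 d) : 𝓢'(Space d, ℂ)) ψ = ∫ x, (𝓕⁻ ψ) x • g x := by
    rw [← Lp.fourierInv_toTemperedDistribution_eq, TemperedDistribution.fourierInv_apply,
      Lp.toTemperedDistribution_apply]
    refine integral_congr_ae ?_
    filter_upwards [h2.coeFn_toLp] with x hx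
    rw [hx]
  have e3 : ∫ x, (𝓕⁻ ψ) x • g x = ∫ x, ψ x • (𝓕⁻ g) x := by
    have hL : Continuous fun p : Space d × Space d => (-innerₗ (Space d)) p.1 p.2 :=
      continuous_inner.neg
    have key := VectorFourier.integral_fourierIntegral_smul_eq_flip (μ := volume) (ν := volume)
      (L := -innerₗ (Space d)) Real.continuous_fourierChar hL ψ.integrable h1
    rw [SchwartzMap.fourierInv_coe]
    -- The inverse transform is the Fourier integral for the pairing `-⟨x, y⟩`, whose symmetry makes
    -- it its own transpose.
    have hflip : (-innerₗ (Space d)).flip = -innerₗ (Space d) := by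
      refine LinearMap.ext₂ fun x y => ?_
      simp [real_inner_comm]
    rw [hflip] at key
    exact key
  rw [e1, e2, e3]
  simp [hval]

/-! ### Multiplication by bounded symbols -/

/-- A measurable symbol bounded by one. -/
structure IsSymbol (m : Space d → ℂ) : Prop where
  measurable : Measurable m
  norm_le_one : ∀ ξ, ‖m ξ‖ ≤ 1

theorem IsSymbol.memLp_mul {m : Space d → ℂ} (hm : IsSymbol m) (f : L2 d) :
    MemLp (fun ξ => m ξ * f ξ) 2 :=
  (Lp.memLp f).of_le (hm.measurable.aestronglyMeasurable.mul (Lp.aestronglyMeasurable f))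
    (ae_of_all _ fun ξ => by
      rw [norm_mul]
      exact mul_le_of_le_one_left (norm_nonneg _) (hm.norm_le_one ξ))

theorem IsSymbol.mul {m n : Space d → ℂ} (hm : IsSymbol m) (hn : IsSymbol n) :
    IsSymbol fun ξ => m ξ * n ξ :=
  ⟨hm.measurable.mul hn.measurable, fun ξ => by
    rw [norm_mul]; exact mul_le_one₀ (hm.norm_le_one ξ) (norm_nonneg _) (hn.norm_le_one ξ)⟩

theorem IsSymbol.indicator {m : Space d → ℂ} (hm : IsSymbol m) {A : Set (Space d)}
    (hA : MeasurableSet A) : IsSymbol (A.indicator m) :=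
  ⟨hm.measurable.indicator hA, fun ξ =>
    (norm_indicator_le_norm_self m ξ).trans (hm.norm_le_one ξ)⟩

/-- Multiplication of an `L²` function by a bounded symbol. -/
def mulOp {m : Space d → ℂ} (hm : IsSymbol m) (f : L2 d) : L2 d :=
  (hm.memLp_mul f).toLp _

theorem mulOp_ae {m : Space d → ℂ} (hm : IsSymbol m) (f : L2 d) :
    mulOp hm f =ᵐ[volume] fun ξ => m ξ * f ξ :=
  MemLp.coeFn_toLp _

theorem mulOp_sub {m : Space d → ℂ} (hm : IsSymbol m) (f g : L2 d) :
    mulOp hm (f - g) = mulOp hm f - mulOp hm g := by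
  refine Lp.ext ?_
  filter_upwards [mulOp_ae hm f, mulOp_ae hm g, mulOp_ae hm (f - g), Lp.coeFn_sub f g,
    Lp.coeFn_sub (mulOp hm f) (mulOp hm g)] with x h1 h2 h3 h4 h5
  simp only [h3, h5, Pi.sub_apply, h4, h1, h2, mul_sub]

theorem mulOp_smul {m : Space d → ℂ} (hm : IsSymbol m) (c : ℂ) (f : L2 d) :
    mulOp hm (c • f) = c • mulOp hm f := by
  refine Lp.ext ?_
  filter_upwards [mulOp_ae hm f, mulOp_ae hm (c • f), Lp.coeFn_smul c f,
    Lp.coeFn_smul c (mulOp hm f)] with x h1 h3 h4 h5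
  simp only [h3, h5, Pi.smul_apply, h4, h1, smul_eq_mul]
  ring

theorem norm_mulOp_le {m : Space d → ℂ} (hm : IsSymbol m) {η : ℝ}
    (h : ∀ ξ, ‖m ξ‖ ≤ η) (f : L2 d) : ‖mulOp hm f‖ ≤ η * ‖f‖ := by
  refine Lp.norm_le_mul_norm_of_ae_le_mul ?_
  filter_upwards [mulOp_ae hm f] with x hx
  rw [hx, norm_mul]
  exact mul_le_mul_of_nonneg_right (h x) (norm_nonneg _)

theorem norm_mulOp_eq {m : Space d → ℂ} (hm : IsSymbol m) (h : ∀ ξ, ‖m ξ‖ = 1) (f : L2 d) :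
    ‖mulOp hm f‖ = ‖f‖ := by
  refine le_antisymm ?_ ?_
  · simpa using norm_mulOp_le hm hm.norm_le_one f
  · refine Lp.norm_le_norm_of_ae_le ?_
    filter_upwards [mulOp_ae hm f] with x hx
    rw [hx, norm_mul, h, one_mul]

/-- Symbols whose difference is a symbol act compatibly. -/
theorem mulOp_sub_mulOp {m n k : Space d → ℂ} (hm : IsSymbol m) (hn : IsSymbol n)
    (hk : IsSymbol k) (h : ∀ ξ, m ξ - n ξ = k ξ) (f : L2 d) :
    mulOp hm f - mulOp hn f = mulOp hk f := by
  refine Lp.ext ?_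
  filter_upwards [mulOp_ae hm f, mulOp_ae hn f, mulOp_ae hk f,
    Lp.coeFn_sub (mulOp hm f) (mulOp hn f)] with x h1 h2 h3 h4
  rw [h4, Pi.sub_apply, h1, h2, h3, ← h, sub_mul]

/-- The Fourier multiplier `f ↦ 𝓕⁻¹ (m f)`. -/
def multiplier {m : Space d → ℂ} (hm : IsSymbol m) (f : L2 d) : L2 d :=
  𝓕⁻ (mulOp hm f)

theorem norm_fourierInv_L2 (f : L2 d) : ‖(𝓕⁻ f : L2 d)‖ = ‖f‖ :=
  (Lp.fourierTransformₗᵢ (Space d) ℂ).symm.norm_map f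

theorem fourierInv_sub_L2 (f g : L2 d) : (𝓕⁻ (f - g) : L2 d) = 𝓕⁻ f - 𝓕⁻ g :=
  map_sub (Lp.fourierTransformₗᵢ (Space d) ℂ).symm f g

theorem fourierInv_smul_L2 (c : ℂ) (f : L2 d) : (𝓕⁻ (c • f) : L2 d) = c • 𝓕⁻ f :=
  map_smul (Lp.fourierTransformₗᵢ (Space d) ℂ).symm c f

theorem multiplier_sub {m : Space d → ℂ} (hm : IsSymbol m) (f g : L2 d) :
    multiplier hm (f - g) = multiplier hm f - multiplier hm g := by
  rw [multiplier, mulOp_sub, fourierInv_sub_L2]; rfl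

theorem multiplier_smul {m : Space d → ℂ} (hm : IsSymbol m) (c : ℂ) (f : L2 d) :
    multiplier hm (c • f) = c • multiplier hm f := by
  rw [multiplier, mulOp_smul, fourierInv_smul_L2]; rfl

theorem multiplier_sub_multiplier {m n k : Space d → ℂ} (hm : IsSymbol m) (hn : IsSymbol n)
    (hk : IsSymbol k) (h : ∀ ξ, m ξ - n ξ = k ξ) (f : L2 d) :
    multiplier hm f - multiplier hn f = multiplier hk f := by
  rw [multiplier, multiplier, ← fourierInv_sub_L2, mulOp_sub_mulOp hm hn hk h]; rfl

theorem norm_multiplier_le {m : Space d → ℂ} (hm : IsSymbol m) {η : ℝ}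
    (h : ∀ ξ, ‖m ξ‖ ≤ η) (f : L2 d) : ‖multiplier hm f‖ ≤ η * ‖f‖ := by
  rw [multiplier, norm_fourierInv_L2]
  exact norm_mulOp_le hm h f

/-! ### Band-limited multipliers -/

/-- The pointwise representative of a band-limited multiplier. -/
def evalAt (m : Space d → ℂ) (f : L2 d) (x : Space d) : ℂ :=
  𝓕⁻ (fun ξ => m ξ * f ξ) x

/-- The symbol of translation by `y`. -/
def charSymbol (y : Space d) (ξ : Space d) : ℂ := (Real.fourierChar (inner ℝ ξ y) : ℂ)

theorem norm_charSymbol (y ξ : Space d) : ‖charSymbol y ξ‖ = 1 := Circle.norm_coe _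

theorem isSymbol_charSymbol (y : Space d) : IsSymbol (charSymbol y) := by
  refine ⟨Continuous.measurable ?_, fun ξ => (norm_charSymbol y ξ).le⟩
  unfold charSymbol
  have := Real.continuous_fourierChar
  fun_prop

theorem evalAt_eq_integral (m : Space d → ℂ) (f : L2 d) (x : Space d) :
    evalAt m f x = ∫ ξ, charSymbol x ξ * (m ξ * f ξ) := by
  rw [evalAt, Real.fourierInv_eq]
  rfl

/-- Modulation in frequency translates the representative. -/
theorem evalAt_mulOp_charSymbol (m : Space d → ℂ) (f : L2 d) (x y : Space d) :
    evalAt m (mulOp (isSymbol_charSymbol y) f) x = evalAt m f (x + y) := by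
  rw [evalAt_eq_integral, evalAt_eq_integral]
  refine integral_congr_ae ?_
  filter_upwards [mulOp_ae (isSymbol_charSymbol y) f] with ξ hξ
  have : charSymbol (x + y) ξ = charSymbol x ξ * charSymbol y ξ := by
    simp [charSymbol, inner_add_right, AddChar.map_add_eq_mul]
  rw [hξ, this]
  ring

theorem IsSymbol.memLp_of_support {m : Space d → ℂ} (hm : IsSymbol m) {R : ℝ}
    (hR : ∀ ξ, R < ‖ξ‖ → m ξ = 0) : MemLp m 2 := by
  have : MemLp ((Metric.closedBall (0 : Space d) R).indicator fun _ => (1 : ℝ)) 2 :=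
    memLp_indicator_const 2 Metric.isClosed_closedBall.measurableSet _
      (Or.inr measure_closedBall_lt_top.ne)
  refine this.of_le hm.measurable.aestronglyMeasurable (ae_of_all _ fun ξ => ?_)
  by_cases h : ‖ξ‖ ≤ R
  · simpa [Set.indicator, h] using hm.norm_le_one ξ
  · simp [hR ξ (not_le.1 h)]

/-- The `L²` function against which a band-limited multiplier is evaluated at `x`. -/
theorem exists_evalAt_eq_inner {m : Space d → ℂ} (hm : IsSymbol m) {R : ℝ}
    (hR : ∀ ξ, R < ‖ξ‖ → m ξ = 0) (x : Space d) :
    ∃ φ : L2 d, ‖φ‖ = (eLpNorm m 2 volume).toReal ∧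
      ∀ f : L2 d, evalAt m f x = inner ℂ φ f := by
  have hsym : IsSymbol fun ξ => charSymbol x ξ * m ξ := (isSymbol_charSymbol x).mul hm
  have hmem : MemLp (fun ξ => (starRingEnd ℂ) (charSymbol x ξ * m ξ)) 2 := by
    refine (hm.memLp_of_support hR).of_le
      (Complex.continuous_conj.measurable.comp hsym.measurable).aestronglyMeasurable
      (ae_of_all _ fun ξ => ?_)
    simp [norm_charSymbol]
  refine ⟨hmem.toLp _, ?_, fun f => ?_⟩
  · rw [Lp.norm_toLp]
    congr 1
    refine eLpNorm_congr_norm_ae (ae_of_all _ fun ξ => ?_)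
    simp [norm_charSymbol]
  · rw [evalAt_eq_integral, L2.inner_def]
    refine integral_congr_ae ?_
    filter_upwards [hmem.coeFn_toLp] with ξ hξ
    rw [hξ]
    simp [RCLike.inner_apply]
    ring

theorem multiplier_ae_evalAt {m : Space d → ℂ} (hm : IsSymbol m) {R : ℝ}
    (hR : ∀ ξ, R < ‖ξ‖ → m ξ = 0) (f : L2 d) :
    multiplier hm f =ᵐ[volume] evalAt m f :=
  fourierInv_toLp_ae ((hm.memLp_of_support hR).integrable_mul (Lp.memLp f)) (hm.memLp_mul f)

theorem eLpNorm_symbol_le {m : Space d → ℂ} {R η : ℝ}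
    (hR : ∀ ξ, R < ‖ξ‖ → m ξ = 0) (h : ∀ ξ, ‖m ξ‖ ≤ η) :
    eLpNorm m 2 volume ≤
      ENNReal.ofReal η * volume (Metric.closedBall (0 : Space d) R) ^ (1 / 2 : ℝ) := by
  have h1 : eLpNorm m 2 volume ≤
      eLpNorm ((Metric.closedBall (0 : Space d) R).indicator fun _ => η) 2 volume := by
    refine eLpNorm_mono_real fun ξ => ?_
    by_cases hξ : ‖ξ‖ ≤ R
    · simpa [Set.indicator, hξ] using h ξ
    · simp [hR ξ (not_le.1 hξ), Set.indicator, hξ]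
  refine h1.trans ((eLpNorm_indicator_const_le η 2).trans ?_)
  have hη : 0 ≤ η := (norm_nonneg _).trans (h 0)
  rw [Real.enorm_eq_ofReal hη]
  simp

/-! ### Bessel symbols and frequency cut-offs -/

/-- The symbol of `(1 - Δ)^{-s/2}`. -/
def besselSymbol (s : ℝ) (ξ : Space d) : ℂ :=
  (((1 + (2 * Real.pi * ‖ξ‖) ^ 2) ^ (-(s / 2)) : ℝ) : ℂ)

theorem norm_besselSymbol (s : ℝ) (ξ : Space d) :
    ‖besselSymbol s ξ‖ = (1 + (2 * Real.pi * ‖ξ‖) ^ 2) ^ (-(s / 2)) := by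
  rw [besselSymbol, Complex.norm_real, Real.norm_eq_abs, abs_of_nonneg (by positivity)]

theorem isSymbol_besselSymbol (hs : 0 ≤ s) : IsSymbol (besselSymbol (d := d) s) := by
  refine ⟨?_, fun ξ => ?_⟩
  · unfold besselSymbol
    fun_prop
  · rw [norm_besselSymbol]
    exact Real.rpow_le_one_of_one_le_of_nonpos (by nlinarith [sq_nonneg (2 * Real.pi * ‖ξ‖)])
      (by linarith)

theorem norm_besselSymbol_le (hs : 0 ≤ s) {r : ℝ} (hr : 0 < r) {ξ : Space d} (h : r ≤ ‖ξ‖) :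
    ‖besselSymbol s ξ‖ ≤ r ^ (-s) := by
  rw [norm_besselSymbol]
  have h1 : r ^ (-s) = (r ^ 2) ^ (-(s / 2)) := by
    rw [← Real.rpow_natCast, ← Real.rpow_mul hr.le]
    congr 1
    push_cast
    ring
  rw [h1]
  refine Real.rpow_le_rpow_of_nonpos (by positivity) ?_ (by linarith)
  have h2 : r ≤ 2 * Real.pi * ‖ξ‖ := by
    nlinarith [Real.pi_gt_three, norm_nonneg ξ]
  nlinarith

/-- The operator `(1 - Δ)^{-s/2} 𝓕⁻¹`, an isometry of `L²` onto `H^s`. -/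
def besselMap (hs : 0 ≤ s) (f : L2 d) : L2 d :=
  multiplier (isSymbol_besselSymbol hs) f

/-- The part of the Bessel symbol at frequencies at most `2 ^ k`. -/
def lowSymbol (s : ℝ) (k : ℕ) : Space d → ℂ :=
  (Metric.closedBall (0 : Space d) (2 ^ k)).indicator (besselSymbol s)

/-- The part of the Bessel symbol at frequencies above `2 ^ k`. -/
def highSymbol (s : ℝ) (k : ℕ) : Space d → ℂ :=
  (Metric.closedBall (0 : Space d) (2 ^ k))ᶜ.indicator (besselSymbol s)

/-- The part of the Bessel symbol at frequencies in `(2 ^ k, 2 ^ (k + 1)]`. -/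
def ringSymbol (s : ℝ) (k : ℕ) : Space d → ℂ :=
  (Metric.closedBall (0 : Space d) (2 ^ k))ᶜ.indicator (lowSymbol s (k + 1))

theorem isSymbol_lowSymbol (hs : 0 ≤ s) (k : ℕ) : IsSymbol (lowSymbol (d := d) s k) :=
  (isSymbol_besselSymbol hs).indicator Metric.isClosed_closedBall.measurableSet

theorem isSymbol_highSymbol (hs : 0 ≤ s) (k : ℕ) : IsSymbol (highSymbol (d := d) s k) :=
  (isSymbol_besselSymbol hs).indicator Metric.isClosed_closedBall.measurableSet.compl

theorem isSymbol_ringSymbol (hs : 0 ≤ s) (k : ℕ) : IsSymbol (ringSymbol (d := d) s k) :=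
  (isSymbol_lowSymbol hs (k + 1)).indicator Metric.isClosed_closedBall.measurableSet.compl

theorem lowSymbol_eq_zero (k : ℕ) (ξ : Space d) (h : 2 ^ k < ‖ξ‖) : lowSymbol s k ξ = 0 := by
  simp [lowSymbol, h]

open scoped Classical in
theorem ringSymbol_eq_zero (k : ℕ) (ξ : Space d) (h : 2 ^ (k + 1) < ‖ξ‖) :
    ringSymbol s k ξ = 0 := by
  rw [ringSymbol, Set.indicator_apply]
  simp [lowSymbol_eq_zero (k + 1) ξ h]

open scoped Classical in
theorem norm_highSymbol_le (hs : 0 ≤ s) (k : ℕ) (ξ : Space d) :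
    ‖highSymbol s k ξ‖ ≤ (2 ^ k : ℝ) ^ (-s) := by
  rw [highSymbol, Set.indicator_apply]
  split_ifs with h
  · exact norm_besselSymbol_le hs (by positivity) (le_of_lt (by simpa using h))
  · rw [norm_zero]; positivity

theorem norm_ringSymbol_le (hs : 0 ≤ s) (k : ℕ) (ξ : Space d) :
    ‖ringSymbol s k ξ‖ ≤ (2 ^ k : ℝ) ^ (-s) := by
  refine le_trans ?_ (norm_highSymbol_le hs k ξ)
  rw [ringSymbol, highSymbol, norm_indicator_eq_indicator_norm, norm_indicator_eq_indicator_norm]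
  exact Set.indicator_le_indicator (norm_indicator_le_norm_self _ _)

/-- The low-frequency part of `besselMap`. -/
def lowMap (hs : 0 ≤ s) (k : ℕ) (f : L2 d) : L2 d :=
  multiplier (isSymbol_lowSymbol hs k) f

theorem besselMap_sub_lowMap (hs : 0 ≤ s) (k : ℕ) (f : L2 d) :
    besselMap hs f - lowMap hs k f = multiplier (isSymbol_highSymbol hs k) f := by
  refine multiplier_sub_multiplier _ _ _ (fun ξ => ?_) f
  by_cases h : ξ ∈ Metric.closedBall (0 : Space d) (2 ^ k) <;> simp [lowSymbol, highSymbol, h]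

theorem lowMap_succ_sub_lowMap (hs : 0 ≤ s) (k : ℕ) (f : L2 d) :
    lowMap hs (k + 1) f - lowMap hs k f = multiplier (isSymbol_ringSymbol hs k) f := by
  refine multiplier_sub_multiplier _ _ _ (fun ξ => ?_) f
  by_cases h : ξ ∈ Metric.closedBall (0 : Space d) (2 ^ k)
  · have h' : ξ ∈ Metric.closedBall (0 : Space d) (2 ^ (k + 1)) :=
      Metric.closedBall_subset_closedBall
        (pow_le_pow_right₀ (by norm_num) (Nat.le_succ k)) h
    rw [ringSymbol, Set.indicator_of_notMem (by simpa using h), lowSymbol, lowSymbol,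
      Set.indicator_of_mem h, Set.indicator_of_mem h', sub_self]
  · rw [ringSymbol, Set.indicator_of_mem h]
    simp [lowSymbol, Set.indicator_of_notMem h]

theorem norm_besselMap_sub_lowMap_le (hs : 0 ≤ s) (k : ℕ) (f : L2 d) :
    ‖besselMap hs f - lowMap hs k f‖ ≤ (2 ^ (-s)) ^ k * ‖f‖ := by
  rw [besselMap_sub_lowMap]
  refine norm_multiplier_le _ (fun ξ => ?_) f
  have h : ((2 : ℝ) ^ k) ^ (-s) = ((2 : ℝ) ^ (-s)) ^ k := by
    rw [← Real.rpow_natCast, ← Real.rpow_natCast, ← Real.rpow_mul (by norm_num),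
      ← Real.rpow_mul (by norm_num), mul_comm]
  rw [← h]
  exact norm_highSymbol_le hs k ξ

theorem two_rpow_neg_lt_one (hs : 0 < s) : (2 : ℝ) ^ (-s) < 1 :=
  Real.rpow_lt_one_of_one_lt_of_neg (by norm_num) (by linarith)

theorem tendsto_lowMap (hs : 0 < s) (f : L2 d) :
    Tendsto (fun k => lowMap hs.le k f) atTop (𝓝 (besselMap hs.le f)) := by
  rw [tendsto_iff_norm_sub_tendsto_zero]
  have h0 : Tendsto (fun k : ℕ => ((2 : ℝ) ^ (-s)) ^ k * ‖f‖) atTop (𝓝 (0 * ‖f‖)) :=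
    (tendsto_pow_atTop_nhds_zero_of_lt_one (by positivity) (two_rpow_neg_lt_one hs)).mul_const _
  rw [zero_mul] at h0
  refine squeeze_zero (fun _ => norm_nonneg _) (fun k => ?_) h0
  rw [norm_sub_rev]
  exact norm_besselMap_sub_lowMap_le hs.le k f

/-! ### The subcritical Sobolev embedding -/

theorem eLpNorm_eq_lqEnergy (hq : 0 < q) (u : L2 d) :
    eLpNorm u (ENNReal.ofReal q) volume = lqEnergy q u ^ (1 / q) := by
  rw [eLpNorm_eq_lintegral_rpow_enorm_toReal (by simpa using hq) ENNReal.ofReal_ne_top,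
    ENNReal.toReal_ofReal hq.le]
  rfl

theorem lqEnergy_two (u : L2 d) : lqEnergy 2 u = ‖u‖ₑ ^ (2 : ℝ) := by
  have h := eLpNorm_eq_lqEnergy (q := 2) (by norm_num) u
  rw [ENNReal.ofReal_ofNat] at h
  rw [Lp.enorm_def, h, ← ENNReal.rpow_mul]
  norm_num

theorem lqEnergy_le_of_ae_le (hq : 2 < q) (u : L2 d) {a : ℝ≥0∞} (h : ∀ᵐ x, ‖u x‖ₑ ≤ a) :
    lqEnergy q u ≤ a ^ (q - 2) * ‖u‖ₑ ^ (2 : ℝ) := by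
  rw [← lqEnergy_two, lqEnergy, lqEnergy, ← lintegral_const_mul'' _
    ((Lp.aestronglyMeasurable u).enorm.pow_const _)]
  refine lintegral_mono_ae ?_
  filter_upwards [h] with x hx
  calc ‖u x‖ₑ ^ q = ‖u x‖ₑ ^ (q - 2) * ‖u x‖ₑ ^ (2 : ℝ) := by
        rw [← ENNReal.rpow_add_of_nonneg _ _ (by linarith) (by norm_num)]; congr 1; ring
    _ ≤ _ := by gcongr

theorem enorm_evalAt_le {m : Space d → ℂ} (hm : IsSymbol m) {R η : ℝ}
    (hR : ∀ ξ, R < ‖ξ‖ → m ξ = 0) (h : ∀ ξ, ‖m ξ‖ ≤ η) (f : L2 d) (x : Space d) :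
    ‖evalAt m f x‖ₑ ≤
      ENNReal.ofReal η * volume (Metric.closedBall (0 : Space d) R) ^ (1 / 2 : ℝ) * ‖f‖ₑ := by
  obtain ⟨φ, hφ, hφ'⟩ := exists_evalAt_eq_inner hm hR x
  have h1 : ‖φ‖ₑ = eLpNorm m 2 volume := by
    rw [← ofReal_norm, hφ, ENNReal.ofReal_toReal (hm.memLp_of_support hR).2.ne]
  rw [hφ']
  calc ‖inner ℂ φ f‖ₑ ≤ ‖φ‖ₑ * ‖f‖ₑ := by
        rw [← ofReal_norm, ← ofReal_norm, ← ofReal_norm, ← ENNReal.ofReal_mul (norm_nonneg _)]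
        exact ENNReal.ofReal_le_ofReal (norm_inner_le_norm φ f)
    _ ≤ _ := by rw [h1]; gcongr; exact eLpNorm_symbol_le hR h

/-- Interpolation between `L²` and `L^∞`: the multiplier is bounded by `e` in `L²` and by `V^{1/2}
e` pointwise, so its energy is at most `(V^{1/2} e)^{q-2} e²`. -/
theorem eLpNorm_multiplier_le (hq : 2 < q) {m : Space d → ℂ} (hm : IsSymbol m) {R η : ℝ}
    (hR : ∀ ξ, R < ‖ξ‖ → m ξ = 0) (h : ∀ ξ, ‖m ξ‖ ≤ η) (f : L2 d) :
    eLpNorm (multiplier hm f) (ENNReal.ofReal q) volume ≤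
      ENNReal.ofReal η * volume (Metric.closedBall (0 : Space d) R) ^ (1 / 2 - 1 / q)
        * ‖f‖ₑ := by
  have hq0 : 0 < q := by linarith
  set V := volume (Metric.closedBall (0 : Space d) R)
  set e := ENNReal.ofReal η * ‖f‖ₑ with he
  have h2 : ‖multiplier hm f‖ₑ ≤ e := by
    rw [he, ← ofReal_norm, ← ofReal_norm,
      ← ENNReal.ofReal_mul ((norm_nonneg _).trans (h 0))]
    exact ENNReal.ofReal_le_ofReal (norm_multiplier_le hm h f)
  have h1 : lqEnergy q (multiplier hm f) ≤ (V ^ (1 / 2 : ℝ) * e) ^ (q - 2) * e ^ (2 : ℝ) := by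
    refine (lqEnergy_le_of_ae_le hq _ (a := V ^ (1 / 2 : ℝ) * e) ?_).trans (by gcongr)
    filter_upwards [multiplier_ae_evalAt hm hR f] with x hx
    rw [hx]
    refine (enorm_evalAt_le hm hR h f x).trans_eq ?_
    rw [he]; ring
  rw [eLpNorm_eq_lqEnergy hq0]
  calc lqEnergy q (multiplier hm f) ^ (1 / q)
      ≤ ((V ^ (1 / 2 : ℝ) * e) ^ (q - 2) * e ^ (2 : ℝ)) ^ (1 / q) := by gcongr
    _ = (V ^ (1 / 2 * (q - 2)) * e ^ q) ^ (1 / q) := by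
        rw [ENNReal.mul_rpow_of_nonneg _ e (by linarith), ← ENNReal.rpow_mul, mul_assoc,
          ← ENNReal.rpow_add_of_nonneg _ _ (by linarith) (by norm_num)]
        congr 3
        ring
    _ = V ^ (1 / 2 - 1 / q) * e := by
        rw [ENNReal.mul_rpow_of_nonneg _ _ (by positivity), ← ENNReal.rpow_mul,
          ← ENNReal.rpow_mul, mul_one_div_cancel hq0.ne', ENNReal.rpow_one]
        congr 2
        field_simp
    _ = _ := by rw [he]; ring

theorem volume_closedBall_two_pow (k : ℕ) {α : ℝ} (hα : 0 ≤ α) :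
    volume (Metric.closedBall (0 : Space d) (2 ^ k)) ^ α =
      ENNReal.ofReal (2 ^ (d * α)) ^ k * volume (Metric.closedBall (0 : Space d) 1) ^ α := by
  rw [Measure.addHaar_closedBall' _ _ (by positivity), ENNReal.mul_rpow_of_nonneg _ _ hα,
    ENNReal.ofReal_rpow_of_nonneg (by positivity) hα, ← ENNReal.ofReal_pow (by positivity)]
  congr 2
  rw [finrank_euclideanSpace_fin, ← Real.rpow_natCast, ← Real.rpow_natCast, ← Real.rpow_natCast,
    ← Real.rpow_mul (by norm_num), ← Real.rpow_mul (by norm_num), ← Real.rpow_mul (by norm_num)]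
  congr 1
  ring

/-- The gap to the critical exponent. -/
theorem subcritical_gap (hsd : s < (d : ℝ) / 2) (hq : 2 < q)
    (hq' : q < 2 * (d : ℝ) / ((d : ℝ) - 2 * s)) : (d : ℝ) * (1 / 2 - 1 / q) < s := by
  have h1 : 0 < (d : ℝ) - 2 * s := by linarith
  rw [lt_div_iff₀ h1] at hq'
  have hq0 : 0 < q := by linarith
  have h2 : (d : ℝ) * (1 / 2 - 1 / q) = (d * q - 2 * d) / (2 * q) := by field_simp
  rw [h2, div_lt_iff₀ (by positivity)]
  linarith

/-- Dyadic decay of the high frequencies in `L^q`, for subcritical `q`. -/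
theorem exists_eLpNorm_ring_le (hs : 0 ≤ s) (hq : 2 < q) (hgap : (d : ℝ) * (1 / 2 - 1 / q) < s) :
    ∃ C r : ℝ≥0∞, C ≠ ∞ ∧ r < 1 ∧ ∀ (k : ℕ) (f : L2 d),
      eLpNorm (multiplier (isSymbol_ringSymbol hs k) f) (ENNReal.ofReal q) volume
        ≤ C * r ^ k * ‖f‖ₑ := by
  set α := 1 / 2 - 1 / q with hα
  have hα0 : 0 ≤ α := by
    rw [hα, sub_nonneg]
    exact one_div_le_one_div_of_le (by norm_num) hq.le
  set V := volume (Metric.closedBall (0 : Space d) 1) ^ α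
  have hV : V ≠ ∞ := ENNReal.rpow_ne_top_of_nonneg hα0 measure_closedBall_lt_top.ne
  -- The ring has amplitude `2^{-ks}` and lies in the ball of radius `2^{k+1}`, which contributes
  -- `2^{dα(k+1)}`. The extra step in the radius goes into the constant, leaving the ratio
  -- `2^{dα-s}`, below one by `hgap`.
  refine ⟨ENNReal.ofReal (2 ^ (d * α)) * V, ENNReal.ofReal (2 ^ (d * α - s)),
    ENNReal.mul_ne_top ENNReal.ofReal_ne_top hV, ?_, fun k f => ?_⟩
  · rw [← ENNReal.ofReal_one, ENNReal.ofReal_lt_ofReal_iff zero_lt_one]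
    exact Real.rpow_lt_one_of_one_lt_of_neg (by norm_num) (by linarith)
  · refine (eLpNorm_multiplier_le hq _ (ringSymbol_eq_zero k) (norm_ringSymbol_le hs k)
      f).trans_eq ?_
    rw [volume_closedBall_two_pow _ hα0, pow_succ]
    have h1 : ENNReal.ofReal ((2 ^ k : ℝ) ^ (-s)) * ENNReal.ofReal (2 ^ (d * α)) ^ k
        = ENNReal.ofReal (2 ^ (d * α - s)) ^ k := by
      rw [← ENNReal.ofReal_pow (by positivity), ← ENNReal.ofReal_pow (by positivity),
        ← ENNReal.ofReal_mul (by positivity), ← Real.rpow_natCast, ← Real.rpow_natCast,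
        ← Real.rpow_natCast, ← Real.rpow_mul (by norm_num), ← Real.rpow_mul (by norm_num),
        ← Real.rpow_mul (by norm_num), ← Real.rpow_add (by norm_num)]
      congr 2
      ring
    rw [← h1]
    ring

/-- Telescoping over the rings and summing the geometric series gives a bound independent of `n`, so
that `n` can later tend to infinity. -/
theorem eLpNorm_lowMap_sub_le (hs : 0 ≤ s) (hq : 2 < q) {C r : ℝ≥0∞}
    (h : ∀ (k : ℕ) (f : L2 d),
      eLpNorm (multiplier (isSymbol_ringSymbol hs k) f) (ENNReal.ofReal q) volume
        ≤ C * r ^ k * ‖f‖ₑ) (k n : ℕ) (f : L2 d) :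
    eLpNorm (lowMap hs (k + n) f - lowMap hs k f : L2 d) (ENNReal.ofReal q) volume
      ≤ C * (1 - r)⁻¹ * r ^ k * ‖f‖ₑ := by
  have key : eLpNorm (lowMap hs (k + n) f - lowMap hs k f : L2 d) (ENNReal.ofReal q) volume
      ≤ C * (∑ j ∈ Finset.range n, r ^ j) * r ^ k * ‖f‖ₑ := by
    induction n with
    | zero =>
      rw [add_zero, sub_self, eLpNorm_congr_ae (Lp.coeFn_zero _ _ _), eLpNorm_zero]
      exact zero_le
    | succ n ih =>
      have e : lowMap hs (k + (n + 1)) f - lowMap hs k f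
          = (lowMap hs (k + n) f - lowMap hs k f)
            + multiplier (isSymbol_ringSymbol hs (k + n)) f := by
        rw [← lowMap_succ_sub_lowMap hs, ← add_assoc]; abel
      rw [e, eLpNorm_congr_ae (Lp.coeFn_add _ _)]
      refine (eLpNorm_add_le (Lp.aestronglyMeasurable _) (Lp.aestronglyMeasurable _) ?_).trans ?_
      · rw [← ENNReal.ofReal_one]
        exact ENNReal.ofReal_le_ofReal (by linarith)
      · refine (add_le_add ih (h (k + n) f)).trans_eq ?_
        rw [Finset.sum_range_succ, pow_add]
        ring
  refine key.trans ?_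
  gcongr
  rw [← ENNReal.tsum_geometric]
  exact ENNReal.sum_le_tsum _

/-- Lower semicontinuity of the `L^q` norm under `L²` convergence. -/
theorem eLpNorm_le_of_tendsto {u : ℕ → L2 d} {v : L2 d} (h : Tendsto u atTop (𝓝 v)) {p M : ℝ≥0∞}
    (hM : ∀ᶠ n in atTop, eLpNorm (u n) p volume ≤ M) : eLpNorm v p volume ≤ M := by
  obtain ⟨ns, hns, hae⟩ := (tendstoInMeasure_of_tendsto_Lp h).exists_seq_tendsto_ae
  refine (Lp.eLpNorm_lim_le_liminf_eLpNorm (fun n => Lp.aestronglyMeasurable (u (ns n))) v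
    hae).trans ?_
  refine liminf_le_of_frequently_le' (Eventually.frequently ?_)
  exact hns.tendsto_atTop.eventually hM

/-- Quantitative subcritical Sobolev embedding: the high frequencies are small in `L^q`. -/
theorem exists_eLpNorm_besselMap_sub_lowMap_le (hs : 0 < s) (hq : 2 < q)
    (hgap : (d : ℝ) * (1 / 2 - 1 / q) < s) :
    ∃ C r : ℝ≥0∞, C ≠ ∞ ∧ r < 1 ∧
      (∀ (k : ℕ) (f : L2 d), eLpNorm (besselMap hs.le f - lowMap hs.le k f : L2 d)
        (ENNReal.ofReal q) volume ≤ C * r ^ k * ‖f‖ₑ) ∧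
      ∀ f : L2 d, eLpNorm (besselMap hs.le f) (ENNReal.ofReal q) volume ≤ C * ‖f‖ₑ := by
  obtain ⟨C, r, hC, hr, h⟩ := exists_eLpNorm_ring_le hs.le hq hgap
  have hr' : (1 - r)⁻¹ ≠ ∞ := by
    rw [ENNReal.inv_ne_top]
    exact (tsub_pos_of_lt hr).ne'
  have h1 : ∀ (k : ℕ) (f : L2 d), eLpNorm (besselMap hs.le f - lowMap hs.le k f : L2 d)
      (ENNReal.ofReal q) volume ≤ C * (1 - r)⁻¹ * r ^ k * ‖f‖ₑ := fun k f => by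
    have ht : Tendsto (fun n => lowMap hs.le (k + n) f - lowMap hs.le k f) atTop
        (𝓝 (besselMap hs.le f - lowMap hs.le k f)) := by
      refine Tendsto.sub_const ?_ _
      simpa [add_comm] using (tendsto_add_atTop_iff_nat k).2 (tendsto_lowMap hs f)
    exact eLpNorm_le_of_tendsto ht
      (Eventually.of_forall fun n => eLpNorm_lowMap_sub_le hs.le hq h k n f)
  set V := volume (Metric.closedBall (0 : Space d) (2 ^ 0)) ^ (1 / 2 - 1 / q)
  have hV : V ≠ ∞ := by
    refine ENNReal.rpow_ne_top_of_nonneg ?_ measure_closedBall_lt_top.ne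
    rw [sub_nonneg]
    exact one_div_le_one_div_of_le (by norm_num) hq.le
  -- One constant serves both claims: `V` pays for the frequencies at most `1`, the geometric sum
  -- for all the others.
  refine ⟨C * (1 - r)⁻¹ + V, r, by finiteness, hr, fun k f => (h1 k f).trans ?_, fun f => ?_⟩
  · gcongr
    exact le_self_add
  · have e : besselMap hs.le f = (besselMap hs.le f - lowMap hs.le 0 f) + lowMap hs.le 0 f := by
      abel
    rw [e, eLpNorm_congr_ae (Lp.coeFn_add _ _)]
    refine (eLpNorm_add_le (Lp.aestronglyMeasurable _) (Lp.aestronglyMeasurable _) ?_).trans ?_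
    · rw [← ENNReal.ofReal_one]
      exact ENNReal.ofReal_le_ofReal (by linarith)
    · have h2 := eLpNorm_multiplier_le hq (isSymbol_lowSymbol hs.le 0) (lowSymbol_eq_zero 0)
        (isSymbol_lowSymbol (d := d) hs.le 0).norm_le_one f
      rw [ENNReal.ofReal_one, one_mul] at h2
      refine (add_le_add (h1 0 f) h2).trans_eq ?_
      rw [pow_zero]
      ring

/-! ### Translations -/

/-- Modulation on the Fourier side is translation in space. -/
theorem besselMap_mulOp_charSymbol (hs : 0 < s) (y : Space d) (f : L2 d) :
    besselMap hs.le (mulOp (isSymbol_charSymbol y) f) =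
      Lp.compMeasurePreserving (· + y) (measurePreserving_add_right volume y)
        (besselMap hs.le f) := by
  have hmp : MeasurePreserving (fun x : Space d => x + y) volume volume :=
    measurePreserving_add_right volume y
  -- Band-limited parts have pointwise representatives, on which the translation is visible. The
  -- general case follows by `L²` limits.
  have h1 : ∀ k, lowMap hs.le k (mulOp (isSymbol_charSymbol y) f) =
      Lp.compMeasurePreserving (· + y) hmp (lowMap hs.le k f) := fun k => by
    refine Lp.ext ?_
    have hlow := fun g : L2 d =>
      multiplier_ae_evalAt (isSymbol_lowSymbol hs.le k) (lowSymbol_eq_zero k) g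
    filter_upwards [hlow (mulOp (isSymbol_charSymbol y) f),
      Lp.coeFn_compMeasurePreserving (lowMap hs.le k f) hmp,
      hmp.quasiMeasurePreserving.ae (hlow f)] with x h2 h3 h4
    rw [h3, lowMap, h2, evalAt_mulOp_charSymbol, Function.comp_apply, lowMap, h4]
  refine tendsto_nhds_unique (tendsto_lowMap hs _) ?_
  simp_rw [h1]
  exact ((Lp.isometry_compMeasurePreserving hmp).continuous.tendsto _).comp (tendsto_lowMap hs f)

theorem lqEnergy_besselMap_mulOp_charSymbol (hs : 0 < s) (y : Space d) (f : L2 d) :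
    lqEnergy q (besselMap hs.le (mulOp (isSymbol_charSymbol y) f)) =
      lqEnergy q (besselMap hs.le f) := by
  have hmp : MeasurePreserving (fun x : Space d => x + y) volume volume :=
    measurePreserving_add_right volume y
  rw [besselMap_mulOp_charSymbol hs]
  calc lqEnergy q _ = ∫⁻ x, ‖besselMap hs.le f (x + y)‖ₑ ^ q := by
        refine lintegral_congr_ae ?_
        filter_upwards [Lp.coeFn_compMeasurePreserving (besselMap hs.le f) hmp] with x hx
        rw [hx]; rfl
    _ = _ := lintegral_add_right_eq_self (fun x => ‖besselMap hs.le f x‖ₑ ^ q) y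

/-! ### Non-vanishing up to translations -/

/-- With `k` chosen so that the high frequencies carry at most half of the `L^q` norm, the low part
has energy at least `β`. Being bounded by one in `L²`, it would have energy at most `D^{q-2} = β/2`
if all its values were below `D`. Its value at `y` is the value at `0` after modulation by `y`, so a
single `φ` representing evaluation at the origin detects every point. -/
theorem exists_nonvanishing (hs : 0 < s) (hq : 2 < q) (hgap : (d : ℝ) * (1 / 2 - 1 / q) < s)
    {c : ℝ≥0∞} (hc : c ≠ 0) (hc' : c ≠ ∞) :
    ∃ (φ : L2 d) (δ : ℝ), 0 < δ ∧ ∀ f : L2 d, ‖f‖ = 1 → c ≤ lqEnergy q (besselMap hs.le f) →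
      ∃ y, δ ≤ ‖(inner ℂ φ (mulOp (isSymbol_charSymbol y) f) : ℂ)‖ := by
  have hq0 : 0 < q := by linarith
  have hq2 : 0 < q - 2 := by linarith
  obtain ⟨C, r, hC, hr, hhigh, -⟩ := exists_eLpNorm_besselMap_sub_lowMap_le (d := d) hs hq hgap
  set c' := c ^ (1 / q) with hc'def
  have hc'0 : c' ≠ 0 := by simp [hc'def, hc, hc']
  have hc'top : c' ≠ ∞ := ENNReal.rpow_ne_top_of_nonneg (by positivity) hc'
  have hhalf0 : 0 < c' / 2 := by simp [hc'0]
  have hhalftop : c' / 2 ≠ ∞ := ENNReal.div_ne_top hc'top (by norm_num)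
  obtain ⟨k, hk⟩ : ∃ k, C * r ^ k ≤ c' / 2 := by
    have h1 : Tendsto (fun k : ℕ => C * r ^ k) atTop (𝓝 (C * 0)) :=
      ENNReal.Tendsto.const_mul (ENNReal.tendsto_pow_atTop_nhds_zero_of_lt_one hr) (Or.inr hC)
    rw [mul_zero] at h1
    exact ((tendsto_order.1 h1).2 _ hhalf0).exists.imp fun _ => le_of_lt
  set β := (c' / 2) ^ q with hβdef
  have hβ0 : β ≠ 0 := by simp [hβdef, hhalf0.ne', hhalftop]
  have hβtop : β ≠ ∞ := ENNReal.rpow_ne_top_of_nonneg hq0.le hhalftop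
  have hβ2 : β / 2 ≠ ∞ := ENNReal.div_ne_top hβtop (by norm_num)
  set D := (β / 2) ^ (1 / (q - 2)) with hDdef
  have hD0 : D ≠ 0 := by simp [hDdef, hβ0, hβ2]
  have hDtop : D ≠ ∞ := ENNReal.rpow_ne_top_of_nonneg (by positivity) hβ2
  have hDpow : D ^ (q - 2) = β / 2 := by
    rw [hDdef, ← ENNReal.rpow_mul, one_div_mul_cancel hq2.ne', ENNReal.rpow_one]
  have hsym := isSymbol_lowSymbol (d := d) hs.le k
  obtain ⟨φ, -, hφ⟩ := exists_evalAt_eq_inner hsym (lowSymbol_eq_zero k) 0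
  refine ⟨φ, D.toReal, ENNReal.toReal_pos hD0 hDtop, fun f hf hcf => ?_⟩
  by_contra! hcon
  have hlow : c' / 2 ≤ eLpNorm (lowMap hs.le k f) (ENNReal.ofReal q) volume := by
    have h1 : c' ≤ c' / 2 + eLpNorm (lowMap hs.le k f) (ENNReal.ofReal q) volume := by
      calc c' ≤ eLpNorm (besselMap hs.le f) (ENNReal.ofReal q) volume := by
            rw [eLpNorm_eq_lqEnergy hq0, hc'def]; gcongr
        _ = eLpNorm ((besselMap hs.le f - lowMap hs.le k f) + lowMap hs.le k f : L2 d)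
            (ENNReal.ofReal q) volume := by rw [sub_add_cancel]
        _ ≤ eLpNorm (besselMap hs.le f - lowMap hs.le k f : L2 d) (ENNReal.ofReal q) volume
            + eLpNorm (lowMap hs.le k f) (ENNReal.ofReal q) volume := by
            rw [eLpNorm_congr_ae (Lp.coeFn_add _ _)]
            refine eLpNorm_add_le (Lp.aestronglyMeasurable _) (Lp.aestronglyMeasurable _) ?_
            rw [← ENNReal.ofReal_one]
            exact ENNReal.ofReal_le_ofReal (by linarith)
        _ ≤ _ := by
            gcongr
            refine (hhigh k f).trans ?_
            rw [← ofReal_norm, hf, ENNReal.ofReal_one, mul_one]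
            exact hk
    nth_rewrite 1 [← ENNReal.add_halves c'] at h1
    exact (ENNReal.add_le_add_iff_left hhalftop).1 h1
  have hle : lqEnergy q (lowMap hs.le k f) ≤ β / 2 := by
    have h2 : ‖lowMap hs.le k f‖ₑ ≤ 1 := by
      rw [← ofReal_norm, ← ENNReal.ofReal_one]
      refine ENNReal.ofReal_le_ofReal ?_
      simpa [hf, lowMap] using norm_multiplier_le hsym hsym.norm_le_one f
    have h3 : ∀ᵐ x, ‖lowMap hs.le k f x‖ₑ ≤ D := by
      filter_upwards [multiplier_ae_evalAt hsym (lowSymbol_eq_zero k) f] with x hx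
      rw [lowMap, hx, ← ofReal_norm, ← ENNReal.ofReal_toReal hDtop]
      refine ENNReal.ofReal_le_ofReal ?_
      have := (hcon x).le
      rwa [← hφ, evalAt_mulOp_charSymbol, zero_add] at this
    calc lqEnergy q (lowMap hs.le k f) ≤ D ^ (q - 2) * ‖lowMap hs.le k f‖ₑ ^ (2 : ℝ) :=
          lqEnergy_le_of_ae_le hq _ h3
      _ ≤ β / 2 * 1 ^ (2 : ℝ) := by rw [hDpow]; gcongr
      _ = β / 2 := by simp
  have hge : β ≤ lqEnergy q (lowMap hs.le k f) := by
    rw [eLpNorm_eq_lqEnergy hq0] at hlow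
    calc β ≤ (lqEnergy q (lowMap hs.le k f) ^ (1 / q)) ^ q := by rw [hβdef]; gcongr
      _ = _ := by rw [← ENNReal.rpow_mul, one_div_mul_cancel hq0.ne', ENNReal.rpow_one]
  exact (ENNReal.half_lt_self hβ0 hβtop).not_ge (hge.trans hle)

/-! ### Weak convergence -/

/-- Weak convergence of a sequence in a Hilbert space. -/
def WeakTendsto {H : Type*} [NormedAddCommGroup H] [InnerProductSpace ℂ H] (f : ℕ → H) (F : H) :
    Prop :=
  ∀ g : H, Tendsto (fun n => (inner ℂ g (f n) : ℂ)) atTop (𝓝 (inner ℂ g F))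

/-- Sequential Banach–Alaoglu in the dual, carried back by the Riesz isomorphism. Conjugation enters
because the dual pairing reads `⟨f n, g⟩` rather than `⟨g, f n⟩`. -/
theorem exists_weakTendsto_subseq {H : Type*} [NormedAddCommGroup H] [InnerProductSpace ℂ H]
    [CompleteSpace H] [TopologicalSpace.SeparableSpace H] (f : ℕ → H) {M : ℝ}
    (hf : ∀ n, ‖f n‖ ≤ M) :
    ∃ (F : H) (ns : ℕ → ℕ), StrictMono ns ∧ WeakTendsto (fun n => f (ns n)) F := by
  have hmem : ∀ n, StrongDual.toWeakDual (InnerProductSpace.toDual ℂ H (f n)) ∈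
      (WeakDual.toStrongDual ⁻¹' Metric.closedBall (0 : StrongDual ℂ H) M) := fun n => by
    simpa using hf n
  obtain ⟨L, -, ns, hns, hL⟩ := WeakDual.isSeqCompact_closedBall ℂ H 0 M hmem
  refine ⟨(InnerProductSpace.toDual ℂ H).symm (WeakDual.toStrongDual L), ns, hns, fun g => ?_⟩
  have h1 := ((WeakDual.eval_continuous g).tendsto L).comp hL
  have h2 := (Complex.continuous_conj.tendsto _).comp h1
  have h3 : (starRingEnd ℂ) (L g)
      = inner ℂ g ((InnerProductSpace.toDual ℂ H).symm (WeakDual.toStrongDual L)) := by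
    rw [← inner_conj_symm, InnerProductSpace.toDual_symm_apply]
    rfl
  rw [← h3]
  refine h2.congr fun n => ?_
  simp only [Function.comp_apply]
  rw [← inner_conj_symm]
  rfl

theorem WeakTendsto.tendsto_norm_sub_sq {H : Type*} [NormedAddCommGroup H] [InnerProductSpace ℂ H]
    {f : ℕ → H} {F : H} (h : WeakTendsto f F) (hf : ∀ n, ‖f n‖ = 1) :
    Tendsto (fun n => ‖f n - F‖ ^ 2) atTop (𝓝 (1 - ‖F‖ ^ 2)) := by
  have h1 : Tendsto (fun n => 1 - 2 * (inner ℂ F (f n) : ℂ).re + ‖F‖ ^ 2) atTop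
      (𝓝 (1 - 2 * (inner ℂ F F : ℂ).re + ‖F‖ ^ 2)) :=
    (((Complex.continuous_re.tendsto _).comp (h F)).const_mul 2).const_sub 1 |>.add_const _
  have h2 : (inner ℂ F F : ℂ).re = ‖F‖ ^ 2 := by
    simpa using inner_self_eq_norm_sq (𝕜 := ℂ) F
  rw [h2, show 1 - 2 * ‖F‖ ^ 2 + ‖F‖ ^ 2 = 1 - ‖F‖ ^ 2 by ring] at h1
  refine h1.congr fun n => ?_
  rw [@norm_sub_sq ℂ, hf n, inner_re_symm]
  simp

/-- A finite measure on `ℝ^d` dominated by and equivalent to Lebesgue measure. -/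
theorem exists_finite_measure_equiv (d : ℕ) :
    ∃ ν : Measure (Space d), IsFiniteMeasure ν ∧ ν ≤ volume ∧ volume ≪ ν := by
  -- The exponent exceeds the dimension, so the weight is integrable; it is at most one and never
  -- vanishes.
  set w : Space d → ℝ := fun x => (1 + ‖x‖) ^ (-((d : ℝ) + 1)) with hw
  have hmeas : Measurable fun x => ENNReal.ofReal (w x) := by
    rw [hw]; fun_prop
  have hint : Integrable w volume := integrable_one_add_norm (by simp)
  refine ⟨volume.withDensity fun x => ENNReal.ofReal (w x),
    isFiniteMeasure_withDensity_ofReal hint.2, ?_, ?_⟩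
  · conv_rhs => rw [← withDensity_one (μ := (volume : Measure (Space d)))]
    refine withDensity_mono (ae_of_all _ fun x => ?_)
    rw [Pi.one_apply, ← ENNReal.ofReal_one]
    exact ENNReal.ofReal_le_ofReal (Real.rpow_le_one_of_one_le_of_nonpos
      (by linarith [norm_nonneg x]) (by linarith [(Nat.cast_nonneg d : (0 : ℝ) ≤ d)]))
  · refine withDensity_absolutelyContinuous' hmeas.aemeasurable (ae_of_all _ fun x => ?_)
    have : 0 < w x := by positivity
    simpa using this

/-- Low-frequency parts of weakly null bounded sequences converge in `L²` of a finite measure. -/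
theorem tendsto_eLpNorm_lowMap (hs : 0 ≤ s) {ν : Measure (Space d)} [IsFiniteMeasure ν]
    (hν : ν ≪ volume) {g : ℕ → L2 d} (hg : WeakTendsto g 0) {M : ℝ} (hM : ∀ n, ‖g n‖ ≤ M) (k : ℕ) :
    Tendsto (fun n => eLpNorm (lowMap hs k (g n)) 2 ν) atTop (𝓝 0) := by
  have hsym := isSymbol_lowSymbol (d := d) hs k
  have hae : ∀ n, lowMap hs k (g n) =ᵐ[ν] evalAt (lowSymbol s k) (g n) := fun n =>
    hν.ae_eq (multiplier_ae_evalAt hsym (lowSymbol_eq_zero k) (g n))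
  set B := volume (Metric.closedBall (0 : Space d) (2 ^ k)) ^ (1 / 2 : ℝ) with hBdef
  have hB : B ≠ ∞ := ENNReal.rpow_ne_top_of_nonneg (by norm_num) measure_closedBall_lt_top.ne
  have hbound : ∀ n x, ‖evalAt (lowSymbol s k) (g n) x‖ₑ ≤ B * ENNReal.ofReal M := fun n x => by
    refine (enorm_evalAt_le hsym (lowSymbol_eq_zero k) hsym.norm_le_one (g n) x).trans ?_
    rw [ENNReal.ofReal_one, one_mul, ← ofReal_norm]
    gcongr
    exact hM n
  have hint : Tendsto (fun n => ∫⁻ x, ‖lowMap hs k (g n) x‖ₑ ^ (2 : ℝ) ∂ν) atTop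
      (𝓝 (∫⁻ _, 0 ∂ν)) := by
    -- Point evaluation is an inner product with a fixed vector, so weak convergence gives pointwise
    -- convergence. The uniform bound is a constant, integrable because `ν` is finite.
    refine tendsto_lintegral_of_dominated_convergence'
      (fun _ => (B * ENNReal.ofReal M) ^ (2 : ℝ)) (fun n => ?_) (fun n => ?_) ?_ ?_
    · exact (((Lp.aestronglyMeasurable (lowMap hs k (g n))).mono_ac hν).enorm).pow_const _
    · filter_upwards [hae n] with x hx
      rw [hx]
      gcongr
      exact hbound n x
    · rw [lintegral_const]
      exact ENNReal.mul_ne_top (ENNReal.rpow_ne_top_of_nonneg (by norm_num)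
        (ENNReal.mul_ne_top hB ENNReal.ofReal_ne_top)) (measure_ne_top _ _)
    · filter_upwards [ae_all_iff.2 hae] with x hx
      obtain ⟨φ, -, hφ⟩ := exists_evalAt_eq_inner hsym (lowSymbol_eq_zero k) x
      have h1 := hg φ
      rw [inner_zero_right] at h1
      have h2 : Tendsto (fun n => ‖lowMap hs k (g n) x‖ₑ) atTop (𝓝 ‖(0 : ℂ)‖ₑ) := by
        refine (continuous_enorm.tendsto _).comp (h1.congr fun n => ?_)
        rw [hx n, hφ]
      have h3 : Tendsto (fun n => ‖lowMap hs k (g n) x‖ₑ ^ (2 : ℝ)) atTop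
          (𝓝 (‖(0 : ℂ)‖ₑ ^ (2 : ℝ))) :=
        ((ENNReal.continuous_rpow_const (y := 2)).tendsto _).comp h2
      simpa using h3
  rw [lintegral_zero] at hint
  have h4 := ((ENNReal.continuous_rpow_const (y := 1 / 2)).tendsto _).comp hint
  rw [ENNReal.zero_rpow_of_pos (by norm_num)] at h4
  refine h4.congr fun n => ?_
  rw [eLpNorm_eq_lintegral_rpow_enorm_toReal (by norm_num) (by norm_num)]
  simp

/-- Local compactness: weak convergence of the densities gives a.e. convergence of a subsequence. -/
theorem WeakTendsto.exists_ae_tendsto (hs : 0 < s) {f : ℕ → L2 d} {F : L2 d}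
    (h : WeakTendsto f F) {M : ℝ} (hM : ∀ n, ‖f n‖ ≤ M) :
    ∃ ns : ℕ → ℕ, StrictMono ns ∧ ∀ᵐ x, Tendsto (fun n => besselMap hs.le (f (ns n)) x) atTop
      (𝓝 (besselMap hs.le F x)) := by
  obtain ⟨ν, hfin, hle, hac⟩ := exists_finite_measure_equiv d
  have hν : ν ≪ volume := Measure.absolutelyContinuous_of_le hle
  set g : ℕ → L2 d := fun n => f n - F with hgdef
  have hg : WeakTendsto g 0 := fun φ => by
    have h1 := (h φ).sub_const (inner ℂ φ F)
    rw [sub_self] at h1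
    simpa [hgdef, inner_sub_right] using h1
  have hgM : ∀ n, ‖g n‖ ≤ M + ‖F‖ := fun n =>
    (norm_sub_le _ _).trans (by gcongr; exact hM n)
  have hlim : Tendsto (fun n => eLpNorm (⇑(besselMap hs.le (f n)) - ⇑(besselMap hs.le F)) 2 ν)
      atTop (𝓝 0) := by
    rw [ENNReal.tendsto_nhds_zero]
    intro ε hε
    have hε2 : 0 < ε / 2 := by simpa using hε.ne'
    -- The cut-off is fixed before `n`: above it the remainder is small in `L²` uniformly in `n`,
    -- and `ν ≤ volume` transfers this to `ν`.
    obtain ⟨k, hk⟩ : ∃ k : ℕ, ENNReal.ofReal (((2 : ℝ) ^ (-s)) ^ k * (M + ‖F‖)) ≤ ε / 2 := by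
      have h1 : Tendsto (fun k : ℕ => ((2 : ℝ) ^ (-s)) ^ k * (M + ‖F‖)) atTop
          (𝓝 (0 * (M + ‖F‖))) :=
        (tendsto_pow_atTop_nhds_zero_of_lt_one (by positivity)
          (two_rpow_neg_lt_one hs)).mul_const _
      have h2 := ENNReal.tendsto_ofReal h1
      rw [zero_mul, ENNReal.ofReal_zero] at h2
      exact ((tendsto_order.1 h2).2 _ hε2).exists.imp fun _ => le_of_lt
    filter_upwards [(ENNReal.tendsto_nhds_zero.1
      (tendsto_eLpNorm_lowMap hs.le hν hg hgM k)) _ hε2] with n hn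
    have e1 : ⇑(besselMap hs.le (f n)) - ⇑(besselMap hs.le F) =ᵐ[ν]
        ⇑(besselMap hs.le (g n) - lowMap hs.le k (g n)) + ⇑(lowMap hs.le k (g n)) := by
      have e2 : besselMap hs.le (f n) - besselMap hs.le F
          = (besselMap hs.le (g n) - lowMap hs.le k (g n)) + lowMap hs.le k (g n) := by
        rw [sub_add_cancel, hgdef]
        exact (multiplier_sub _ _ _).symm
      refine hν.ae_eq ((Lp.coeFn_sub _ _).symm.trans ?_)
      rw [e2]
      exact Lp.coeFn_add _ _
    rw [eLpNorm_congr_ae e1, ← ENNReal.add_halves ε]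
    refine (eLpNorm_add_le ((Lp.aestronglyMeasurable _).mono_ac hν)
      ((Lp.aestronglyMeasurable _).mono_ac hν) (by norm_num)).trans (add_le_add ?_ hn)
    refine (eLpNorm_mono_measure _ hle).trans (le_trans ?_ hk)
    rw [← Lp.enorm_def, ← ofReal_norm]
    refine ENNReal.ofReal_le_ofReal ((norm_besselMap_sub_lowMap_le hs.le k (g n)).trans ?_)
    gcongr
    exact hgM n
  obtain ⟨ns, hns, hae⟩ := (tendstoInMeasure_of_tendsto_eLpNorm (by norm_num)
    (fun n => (Lp.aestronglyMeasurable (besselMap hs.le (f n))).mono_ac hν)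
    ((Lp.aestronglyMeasurable (besselMap hs.le F)).mono_ac hν) hlim).exists_seq_tendsto_ae
  exact ⟨ns, hns, hac hae⟩

/-! ### The unit sphere of `H^s` -/

theorem weight_mul_besselSymbol (s : ℝ) (ξ : Space d) :
    (((1 + (2 * Real.pi * ‖ξ‖) ^ 2) ^ (s / 2) : ℝ) : ℂ) * besselSymbol s ξ = 1 := by
  rw [besselSymbol, ← Complex.ofReal_mul, ← Real.rpow_add (by positivity), add_neg_cancel,
    Real.rpow_zero, Complex.ofReal_one]

theorem fourier_besselMap (hs : 0 ≤ s) (f : L2 d) :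
    (𝓕 (besselMap hs f) : L2 d) = mulOp (isSymbol_besselSymbol hs) f :=
  fourier_fourierInv_eq _

theorem hsNorm_besselMap (hs : 0 ≤ s) (f : L2 d) : hsNorm s (besselMap hs f) = ‖f‖ₑ := by
  rw [hsNorm, Lp.enorm_def, fourier_besselMap]
  refine eLpNorm_congr_ae ?_
  filter_upwards [mulOp_ae (isSymbol_besselSymbol hs) f] with ξ hξ
  rw [hξ, Complex.real_smul, ← mul_assoc, weight_mul_besselSymbol, one_mul]

/-- `MemSobolev` uses the weight `(1 + |ξ|²)^{s/2}`, without the factor `2π`. It is dominated by the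
weight in `hsNorm`, so its product with the Bessel symbol is still bounded by one. -/
theorem memHs_besselMap (hs : 0 ≤ s) (f : L2 d) : MemHs s (besselMap hs f) := by
  have hbound : ∀ ξ : Space d, ‖(((1 + ‖ξ‖ ^ 2) ^ (s / 2) : ℝ) : ℂ) * besselSymbol s ξ‖ ≤ 1 :=
    fun ξ => by
      refine le_trans ?_ (congrArg norm (weight_mul_besselSymbol s ξ)).le |>.trans norm_one.le
      rw [norm_mul, norm_mul]
      refine mul_le_mul_of_nonneg_right ?_ (norm_nonneg _)
      rw [Complex.norm_real, Complex.norm_real, Real.norm_of_nonneg (by positivity),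
        Real.norm_of_nonneg (by positivity)]
      refine Real.rpow_le_rpow (by positivity) ?_ (by linarith)
      gcongr
      nlinarith [Real.pi_gt_three, norm_nonneg ξ]
  have hsym : IsSymbol fun ξ : Space d =>
      (((1 + ‖ξ‖ ^ 2) ^ (s / 2) : ℝ) : ℂ) * besselSymbol s ξ :=
    ⟨Measurable.mul (by fun_prop) (isSymbol_besselSymbol hs).measurable, hbound⟩
  rw [MemHs, memSobolev_iff_exists_smulLeftCLM_fourier]
  refine ⟨mulOp hsym f, ?_⟩
  rw [Lp.fourier_toTemperedDistribution_eq, fourier_besselMap]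
  ext φ
  rw [TemperedDistribution.smulLeftCLM_apply_apply, Lp.toTemperedDistribution_apply,
    Lp.toTemperedDistribution_apply]
  refine integral_congr_ae ?_
  filter_upwards [mulOp_ae hsym f, mulOp_ae (isSymbol_besselSymbol hs) f] with ξ h1 h2
  rw [h1, h2, SchwartzMap.smulLeftCLM_apply_apply (by fun_prop)]
  simp only [smul_eq_mul]
  ring

theorem exists_besselMap_eq (hs : 0 ≤ s) {u : L2 d} (hu : hsNorm s u = 1) :
    ∃ f : L2 d, ‖f‖ = 1 ∧ besselMap hs f = u := by
  set g : Space d → ℂ := fun ξ =>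
    (1 + (2 * Real.pi * ‖ξ‖) ^ 2) ^ (s / 2) • (𝓕 u : L2 d) ξ with hg
  have hmem : MemLp g 2 := by
    refine ⟨?_, ?_⟩
    · have hw : Measurable fun ξ : Space d => (1 + (2 * Real.pi * ‖ξ‖) ^ 2) ^ (s / 2) := by
        fun_prop
      exact hw.aestronglyMeasurable.smul (Lp.aestronglyMeasurable (𝓕 u : L2 d))
    · change hsNorm s u < ∞
      rw [hu]
      exact ENNReal.one_lt_top
  refine ⟨hmem.toLp g, ?_, ?_⟩
  · rw [Lp.norm_toLp]
    change (hsNorm s u).toReal = 1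
    rw [hu, ENNReal.toReal_one]
  · have h1 : mulOp (isSymbol_besselSymbol hs) (hmem.toLp g) = 𝓕 u := by
      refine Lp.ext ?_
      filter_upwards [mulOp_ae (isSymbol_besselSymbol hs) (hmem.toLp g), hmem.coeFn_toLp]
        with ξ h2 h3
      rw [h2, h3]
      simp only [hg]
      rw [Complex.real_smul, ← mul_assoc, mul_comm (besselSymbol s ξ),
        weight_mul_besselSymbol, one_mul]
    rw [besselMap, multiplier, h1, fourierInv_fourier_eq]

/-- The condition on `hsNorm` alone produces the density `f`, and membership in `H^s` then comes for
free. -/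
theorem hsSphere_eq_image (hs : 0 ≤ s) :
    hsSphere d s = besselMap hs '' {f | ‖f‖ = 1} := by
  ext u
  constructor
  · rintro ⟨-, hu⟩
    exact exists_besselMap_eq hs hu
  · rintro ⟨f, hf, rfl⟩
    refine ⟨memHs_besselMap hs f, ?_⟩
    rw [hsNorm_besselMap, ← ofReal_norm, hf, ENNReal.ofReal_one]

theorem lqEnergy_le_bestConst (hs : 0 ≤ s) {f : L2 d} (hf : ‖f‖ = 1) :
    lqEnergy q (besselMap hs f) ≤ bestConst d s q := by
  refine le_sSup ⟨besselMap hs f, ?_, rfl⟩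
  rw [hsSphere_eq_image hs]
  exact ⟨f, hf, rfl⟩

theorem lqEnergy_smul (hq : 0 ≤ q) (c : ℂ) (u : L2 d) :
    lqEnergy q (c • u) = ‖c‖ₑ ^ q * lqEnergy q u := by
  rw [lqEnergy, lqEnergy, ← lintegral_const_mul'' _
    ((Lp.aestronglyMeasurable u).enorm.pow_const _)]
  refine lintegral_congr_ae ?_
  filter_upwards [Lp.coeFn_smul c u] with x hx
  rw [hx, Pi.smul_apply, enorm_smul, ENNReal.mul_rpow_of_nonneg _ _ hq]

theorem lqEnergy_eq_zero_iff (hq : 0 < q) (u : L2 d) : lqEnergy q u = 0 ↔ u = 0 := by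
  rw [lqEnergy, lintegral_eq_zero_iff' ((Lp.aestronglyMeasurable u).enorm.pow_const _),
    Lp.eq_zero_iff_ae_eq_zero]
  refine eventually_congr (Eventually.of_forall fun x => ?_)
  simp [hq]

theorem besselMap_zero (hs : 0 ≤ s) : besselMap hs (0 : L2 d) = 0 := by
  simpa [besselMap] using multiplier_smul (isSymbol_besselSymbol hs) 0 (0 : L2 d)

/-- Homogeneous form of the definition of the supremum, to be applied to the weak limit and to the
remainders, whose norms need not be one. -/
theorem lqEnergy_besselMap_le (hs : 0 ≤ s) (hq : 0 < q) (f : L2 d) :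
    lqEnergy q (besselMap hs f) ≤ bestConst d s q * ‖f‖ₑ ^ q := by
  by_cases hf : f = 0
  · rw [hf, (lqEnergy_eq_zero_iff hq _).2 (besselMap_zero hs)]
    exact zero_le
  · have hn : ‖f‖ ≠ 0 := norm_ne_zero_iff.2 hf
    set g : L2 d := ((‖f‖⁻¹ : ℝ) : ℂ) • f with hgdef
    have hg : ‖g‖ = 1 := by
      rw [hgdef, norm_smul, Complex.norm_real, norm_inv, norm_norm, inv_mul_cancel₀ hn]
    have hfg : f = ((‖f‖ : ℝ) : ℂ) • g := by
      rw [hgdef, smul_smul, ← Complex.ofReal_mul, mul_inv_cancel₀ hn, Complex.ofReal_one, one_smul]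
    have h1 : besselMap hs f = ((‖f‖ : ℝ) : ℂ) • besselMap hs g := by
      conv_lhs => rw [hfg]
      exact multiplier_smul _ _ _
    rw [h1, lqEnergy_smul hq.le, mul_comm]
    have h2 : ‖((‖f‖ : ℝ) : ℂ)‖ₑ = ‖f‖ₑ := by
      rw [← ofReal_norm, Complex.norm_real, norm_norm, ofReal_norm]
    rw [h2]
    gcongr
    exact lqEnergy_le_bestConst hs hg

theorem besselMap_eq_zero_iff (hs : 0 ≤ s) (f : L2 d) : besselMap hs f = 0 ↔ f = 0 := by
  refine ⟨fun h => ?_, by rintro rfl; exact besselMap_zero hs⟩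
  have h1 := hsNorm_besselMap hs f
  rw [h, ← besselMap_zero hs, hsNorm_besselMap, enorm_zero] at h1
  simpa using h1.symm

theorem exists_norm_eq_one (d : ℕ) : ∃ f : L2 d, ‖f‖ = 1 := by
  have hball : MeasurableSet (Metric.closedBall (0 : Space d) 1) :=
    Metric.isClosed_closedBall.measurableSet
  set f : L2 d := indicatorConstLp 2 hball measure_closedBall_lt_top.ne (1 : ℂ) with hf
  have hpos : f ≠ 0 := by
    rw [← norm_ne_zero_iff, hf, norm_indicatorConstLp (by norm_num) (by norm_num)]
    have hv : 0 < volume.real (Metric.closedBall (0 : Space d) 1) :=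
      ENNReal.toReal_pos (Metric.measure_closedBall_pos volume _ one_pos).ne'
        measure_closedBall_lt_top.ne
    simpa using hv.ne'
  exact ⟨((‖f‖⁻¹ : ℝ) : ℂ) • f, by
    rw [norm_smul, Complex.norm_real, norm_inv, norm_norm,
      inv_mul_cancel₀ (norm_ne_zero_iff.2 hpos)]⟩

theorem bestConst_pos (hs : 0 ≤ s) (hq : 0 < q) : bestConst d s q ≠ 0 := by
  obtain ⟨f, hf⟩ := exists_norm_eq_one d
  intro h
  have h1 := lqEnergy_le_bestConst (q := q) hs hf
  rw [h, nonpos_iff_eq_zero, lqEnergy_eq_zero_iff hq, besselMap_eq_zero_iff] at h1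
  simp [h1] at hf

theorem bestConst_lt_top (hs : 0 < s) (hq : 2 < q) (hgap : (d : ℝ) * (1 / 2 - 1 / q) < s) :
    bestConst d s q < ∞ := by
  obtain ⟨C, r, hC, hr, -, h⟩ := exists_eLpNorm_besselMap_sub_lowMap_le (d := d) hs hq hgap
  have hq0 : 0 < q := by linarith
  refine lt_of_le_of_lt (b := C ^ q) (sSup_le ?_)
    (ENNReal.rpow_lt_top_of_nonneg hq0.le hC)
  rw [hsSphere_eq_image hs.le]
  rintro _ ⟨_, ⟨f, hf, rfl⟩, rfl⟩
  have h1 := h f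
  rw [eLpNorm_eq_lqEnergy hq0, ← ofReal_norm, hf, ENNReal.ofReal_one, mul_one,
    one_div, ENNReal.rpow_inv_le_iff hq0] at h1
  exact h1

/-! ### Splitting of the energy -/

/-- Convexity of `x ↦ x^q` applied to `a + b = θ (a/θ) + (1 - θ) (b/(1 - θ))`. As `θ → 0` the
coefficient of `b^q` tends to one; that of `a^q` blows up, but it will only enter through a
dominating function. -/
theorem add_rpow_le_split (hq : 1 < q) {θ : ℝ} (hθ : 0 < θ) (hθ1 : θ < 1) (a b : ℝ≥0∞) :
    (a + b) ^ q ≤ ENNReal.ofReal (θ ^ (1 - q)) * a ^ q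
      + ENNReal.ofReal ((1 - θ) ^ (1 - q)) * b ^ q := by
  have key : ∀ t : ℝ, 0 < t → ∀ c : ℝ≥0∞,
      ENNReal.ofReal t * (ENNReal.ofReal t⁻¹ * c) ^ q = ENNReal.ofReal (t ^ (1 - q)) * c ^ q := by
    intro t ht c
    rw [ENNReal.mul_rpow_of_nonneg _ _ (by linarith), ← mul_assoc,
      ENNReal.ofReal_rpow_of_pos (by positivity), ← ENNReal.ofReal_mul ht.le]
    congr 2
    rw [Real.inv_rpow ht.le, ← Real.rpow_neg ht.le, sub_eq_add_neg, Real.rpow_add ht,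
      Real.rpow_one]
  have cancel : ∀ t : ℝ, 0 < t → ∀ c : ℝ≥0∞,
      ENNReal.ofReal t * (ENNReal.ofReal t⁻¹ * c) = c := by
    intro t ht c
    rw [← mul_assoc, ← ENNReal.ofReal_mul ht.le, mul_inv_cancel₀ ht.ne', ENNReal.ofReal_one,
      one_mul]
  have h := ENNReal.rpow_arith_mean_le_arith_mean2_rpow (ENNReal.ofReal θ)
    (ENNReal.ofReal (1 - θ)) (ENNReal.ofReal θ⁻¹ * a) (ENNReal.ofReal (1 - θ)⁻¹ * b)
    (by rw [← ENNReal.ofReal_add hθ.le (by linarith)]; simp) hq.le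
  rwa [cancel θ hθ, cancel (1 - θ) (by linarith), key θ hθ, key (1 - θ) (by linarith)] at h

/-- One-sided Brezis–Lieb splitting: along an a.e. convergent sequence, the energy is
asymptotically at most the energy of the limit plus almost the energy of the remainder. -/
theorem le_lqEnergy_add_of_tendsto (hq : 1 < q) {u : ℕ → L2 d} {v : L2 d}
    (hae : ∀ᵐ x, Tendsto (fun n => u n x) atTop (𝓝 (v x))) (hv : lqEnergy q v ≠ ∞)
    {S K : ℝ≥0∞} (hS : Tendsto (fun n => lqEnergy q (u n)) atTop (𝓝 S))
    {κ : ℕ → ℝ≥0∞} (hκ : Tendsto κ atTop (𝓝 K)) (hle : ∀ n, lqEnergy q (u n - v) ≤ κ n)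
    {θ : ℝ} (hθ : 0 < θ) (hθ1 : θ < 1) :
    S ≤ lqEnergy q v + ENNReal.ofReal ((1 - θ) ^ (1 - q)) * K := by
  have hq0 : 0 < q := by linarith
  set A := ENNReal.ofReal ((1 - θ) ^ (1 - q)) with hA
  have hdiff : ∀ᵐ x, ∀ n, (u n - v : L2 d) x = u n x - v x :=
    ae_all_iff.2 fun n => Lp.coeFn_sub (u n) v
  have hmu : ∀ n, AEMeasurable (fun x => ‖u n x‖ₑ ^ q) volume := fun n =>
    (Lp.aestronglyMeasurable (u n)).enorm.pow_const _
  have hmd : ∀ n, AEMeasurable (fun x => A * ‖(u n - v : L2 d) x‖ₑ ^ q) volume := fun n =>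
    ((Lp.aestronglyMeasurable (u n - v)).enorm.pow_const _).const_mul _
  -- The subtraction is truncated at zero, so the upper bound by a multiple of `‖v‖ₑ ^ q` from
  -- `add_rpow_le_split` suffices for dominated convergence.
  have hW : Tendsto (fun n => ∫⁻ x, (‖u n x‖ₑ ^ q - A * ‖(u n - v : L2 d) x‖ₑ ^ q)) atTop
      (𝓝 (lqEnergy q v)) := by
    refine tendsto_lintegral_of_dominated_convergence'
      (fun x => ENNReal.ofReal (θ ^ (1 - q)) * ‖v x‖ₑ ^ q) (fun n => (hmu n).sub (hmd n))
      (fun n => ?_) ?_ ?_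
    · filter_upwards [hdiff] with x hx
      rw [tsub_le_iff_right]
      refine le_trans ?_
        (add_rpow_le_split hq hθ hθ1 ‖v x‖ₑ ‖(u n - v : L2 d) x‖ₑ)
      gcongr
      calc ‖u n x‖ₑ = ‖v x + (u n - v : L2 d) x‖ₑ := by rw [hx]; congr 1; ring
        _ ≤ _ := enorm_add_le _ _
    · rw [lintegral_const_mul'' _ ((Lp.aestronglyMeasurable v).enorm.pow_const _)]
      exact ENNReal.mul_ne_top ENNReal.ofReal_ne_top hv
    · filter_upwards [hae, hdiff] with x hx hx'
      have h1 : Tendsto (fun n => ‖u n x‖ₑ ^ q) atTop (𝓝 (‖v x‖ₑ ^ q)) :=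
        (ENNReal.continuous_rpow_const.tendsto _).comp ((continuous_enorm.tendsto _).comp hx)
      have h2 : Tendsto (fun n => ‖(u n - v : L2 d) x‖ₑ) atTop (𝓝 ‖(0 : ℂ)‖ₑ) := by
        have h3 := hx.sub_const (v x)
        rw [sub_self] at h3
        refine (continuous_enorm.tendsto _).comp (h3.congr fun n => ?_)
        rw [hx']
      have h4 : Tendsto (fun n => A * ‖(u n - v : L2 d) x‖ₑ ^ q) atTop
          (𝓝 (A * ‖(0 : ℂ)‖ₑ ^ q)) :=
        ENNReal.Tendsto.const_mul ((ENNReal.continuous_rpow_const.tendsto _).comp h2)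
          (Or.inr ENNReal.ofReal_ne_top)
      have h5 := ENNReal.Tendsto.sub h1 h4 (Or.inr (by simp [hq0]))
      simpa [hq0] using h5
  refine le_of_tendsto_of_tendsto hS
    (hW.add (ENNReal.Tendsto.const_mul hκ (Or.inr ENNReal.ofReal_ne_top)))
    (Eventually.of_forall fun n => ?_)
  calc lqEnergy q (u n)
      ≤ ∫⁻ x, ((‖u n x‖ₑ ^ q - A * ‖(u n - v : L2 d) x‖ₑ ^ q)
          + A * ‖(u n - v : L2 d) x‖ₑ ^ q) := lintegral_mono fun x => le_tsub_add
    _ = (∫⁻ x, (‖u n x‖ₑ ^ q - A * ‖(u n - v : L2 d) x‖ₑ ^ q))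
          + A * lqEnergy q (u n - v) := by
        rw [lintegral_add_right' _ (hmd n),
          lintegral_const_mul'' _ ((Lp.aestronglyMeasurable (u n - v)).enorm.pow_const _)]
        rfl
    _ ≤ _ := add_le_add le_rfl (mul_le_mul' le_rfl (hle n))

/-- Letting the splitting parameter tend to zero. -/
theorem le_add_of_forall_split {S E K : ℝ≥0∞} (hK : K ≠ ∞)
    (h : ∀ θ : ℝ, 0 < θ → θ < 1 → S ≤ E + ENNReal.ofReal ((1 - θ) ^ (1 - q)) * K) :
    S ≤ E + K := by
  have h1 : Tendsto (fun θ : ℝ => (1 - θ) ^ (1 - q)) (𝓝[>] 0) (𝓝 ((1 - 0) ^ (1 - q))) := by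
    have hc : ContinuousAt (fun θ : ℝ => (1 - θ) ^ (1 - q)) 0 :=
      ContinuousAt.rpow_const (by fun_prop) (Or.inl (by norm_num))
    exact hc.tendsto.mono_left nhdsWithin_le_nhds
  have h2 : Tendsto (fun θ : ℝ => E + ENNReal.ofReal ((1 - θ) ^ (1 - q)) * K) (𝓝[>] 0)
      (𝓝 (E + ENNReal.ofReal ((1 - 0) ^ (1 - q)) * K)) :=
    tendsto_const_nhds.add (ENNReal.Tendsto.mul_const (ENNReal.tendsto_ofReal h1) (Or.inr hK))
  rw [sub_zero, Real.one_rpow, ENNReal.ofReal_one, one_mul] at h2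
  refine ge_of_tendsto h2 ?_
  filter_upwards [Ioo_mem_nhdsGT (zero_lt_one' ℝ)] with θ hθ
  exact h θ hθ.1 hθ.2

/-! ### Existence of an optimizer -/

/-- The strict inequality excluding dichotomy. -/
theorem rpow_add_rpow_lt_one (hq : 2 < q) {t : ℝ} (ht : 0 < t) (ht1 : t < 1) :
    t ^ q + √(1 - t ^ 2) ^ q < 1 := by
  have hpow : ∀ x : ℝ, 0 < x → x < 1 → x ^ q < x ^ 2 := fun x hx hx1 => by
    rw [← Real.rpow_natCast]
    exact Real.rpow_lt_rpow_of_exponent_gt hx hx1 (by simpa using hq)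
  have h1 : 0 < 1 - t ^ 2 := by nlinarith
  have h2 : √(1 - t ^ 2) < 1 := by
    rw [Real.sqrt_lt' one_pos]
    nlinarith
  have h3 := hpow _ (Real.sqrt_pos.2 h1) h2
  rw [Real.sq_sqrt h1.le] at h3
  linarith [hpow t ht ht1]

/-- A maximizing sequence with a nonzero weak limit has an optimizer as its limit. -/
theorem norm_eq_one_of_weakTendsto (hs : 0 < s) (hq : 2 < q) (hfin : bestConst d s q < ∞)
    {f : ℕ → L2 d} {F : L2 d} (hf : ∀ n, ‖f n‖ = 1) (hweak : WeakTendsto f F) (hF : F ≠ 0)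
    (hS : Tendsto (fun n => lqEnergy q (besselMap hs.le (f n))) atTop (𝓝 (bestConst d s q)))
    (hae : ∀ᵐ x, Tendsto (fun n => besselMap hs.le (f n) x) atTop (𝓝 (besselMap hs.le F x))) :
    ‖F‖ = 1 ∧ lqEnergy q (besselMap hs.le F) = bestConst d s q := by
  have hq0 : 0 < q := by linarith
  set S := bestConst d s q with hSdef
  have hSpos : S ≠ 0 := bestConst_pos hs.le hq0
  have hFE := lqEnergy_besselMap_le hs.le hq0 F
  have hsq := hweak.tendsto_norm_sub_sq hf
  have hnonneg : 0 ≤ 1 - ‖F‖ ^ 2 := ge_of_tendsto' hsq fun n => by positivity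
  have hF1 : ‖F‖ ≤ 1 := by nlinarith [norm_nonneg F]
  have hnorm : Tendsto (fun n => ‖f n - F‖) atTop (𝓝 √(1 - ‖F‖ ^ 2)) := by
    have h1 := (Real.continuous_sqrt.tendsto _).comp hsq
    refine h1.congr fun n => ?_
    simp [Real.sqrt_sq]
  set K := S * ENNReal.ofReal √(1 - ‖F‖ ^ 2) ^ q with hKdef
  have hκ : Tendsto (fun n => S * ENNReal.ofReal ‖f n - F‖ ^ q) atTop (𝓝 K) :=
    ENNReal.Tendsto.const_mul
      ((ENNReal.continuous_rpow_const.tendsto _).comp (ENNReal.tendsto_ofReal hnorm))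
      (Or.inr hfin.ne)
  have hEtop : lqEnergy q (besselMap hs.le F) ≠ ∞ :=
    (hFE.trans_lt (ENNReal.mul_lt_top hfin
      (ENNReal.rpow_lt_top_of_nonneg hq0.le enorm_ne_top))).ne
  -- The remainder `f n - F` has squared norm tending to `1 - ‖F‖²`, so its energy is asymptotically
  -- at most `K`.
  have hsplit : S ≤ lqEnergy q (besselMap hs.le F) + K := by
    refine le_add_of_forall_split (q := q)
      (ENNReal.mul_ne_top hfin.ne (ENNReal.rpow_ne_top_of_nonneg hq0.le ENNReal.ofReal_ne_top))
      fun θ hθ hθ1 => ?_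
    refine le_lqEnergy_add_of_tendsto (by linarith) hae hEtop hS hκ (fun n => ?_) hθ hθ1
    have h1 := lqEnergy_besselMap_le (q := q) hs.le hq0 (f n - F)
    rw [← ofReal_norm] at h1
    rwa [besselMap, multiplier_sub] at h1
  have hone : ‖F‖ = 1 := by
    by_contra hne
    have hlt : ‖F‖ < 1 := lt_of_le_of_ne hF1 hne
    have h1 : S ≤ S * ENNReal.ofReal (‖F‖ ^ q + √(1 - ‖F‖ ^ 2) ^ q) := by
      refine (hsplit.trans (add_le_add_left hFE K)).trans_eq ?_
      rw [hKdef, ← mul_add, ← ofReal_norm,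
        ENNReal.ofReal_rpow_of_nonneg (norm_nonneg _) hq0.le,
        ENNReal.ofReal_rpow_of_nonneg (Real.sqrt_nonneg _) hq0.le,
        ← ENNReal.ofReal_add (by positivity) (by positivity)]
    have h2 : ENNReal.ofReal (‖F‖ ^ q + √(1 - ‖F‖ ^ 2) ^ q) < 1 := by
      rw [ENNReal.ofReal_lt_one]
      exact rpow_add_rpow_lt_one hq (norm_pos_iff.2 hF) hlt
    have h3 := ENNReal.mul_lt_mul_right hSpos hfin.ne h2
    rw [mul_one] at h3
    exact h3.not_ge h1
  refine ⟨hone, le_antisymm (lqEnergy_le_bestConst hs.le hone) ?_⟩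
  have hK0 : K = 0 := by
    rw [hKdef, hone]
    simp [hq0]
  rwa [hK0, add_zero] at hsplit

/-- There is a maximizing sequence of densities bounded away from weak vanishing. -/
theorem exists_maximizing_seq (hs : 0 < s) (hq : 2 < q)
    (hgap : (d : ℝ) * (1 / 2 - 1 / q) < s) (hfin : bestConst d s q < ∞) :
    ∃ (f : ℕ → L2 d) (φ : L2 d) (δ : ℝ), 0 < δ ∧ (∀ n, ‖f n‖ = 1) ∧
      Tendsto (fun n => lqEnergy q (besselMap hs.le (f n))) atTop (𝓝 (bestConst d s q)) ∧
      ∀ᶠ n in atTop, δ ≤ ‖(inner ℂ φ (f n) : ℂ)‖ := by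
  have hq0 : 0 < q := by linarith
  set S := bestConst d s q with hSdef
  have hSpos : S ≠ 0 := bestConst_pos hs.le hq0
  obtain ⟨f₀, hf₀⟩ := exists_norm_eq_one d
  have hne : (lqEnergy q '' hsSphere d s).Nonempty := by
    rw [hsSphere_eq_image hs.le]
    exact ⟨_, _, ⟨f₀, hf₀, rfl⟩, rfl⟩
  obtain ⟨e, -, he, hmem⟩ := exists_seq_tendsto_sSup hne (OrderTop.bddAbove _)
  have hex : ∀ n, ∃ g : L2 d, ‖g‖ = 1 ∧ lqEnergy q (besselMap hs.le g) = e n := fun n => by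
    obtain ⟨u, hu, hue⟩ := hmem n
    rw [hsSphere_eq_image hs.le] at hu
    obtain ⟨g, hg, rfl⟩ := hu
    exact ⟨g, hg, hue⟩
  choose g hg hge using hex
  obtain ⟨φ, δ, hδ, hnv⟩ := exists_nonvanishing hs hq hgap (c := S / 2)
    (by simp [hSpos]) (ENNReal.div_ne_top hfin.ne (by norm_num))
  -- Non-vanishing applies only once the energy reaches `S / 2`, which holds eventually; for the
  -- other indices the translation is arbitrary and set to `0`.
  have hy : ∀ n, ∃ y, S / 2 ≤ lqEnergy q (besselMap hs.le (g n)) →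
      δ ≤ ‖(inner ℂ φ (mulOp (isSymbol_charSymbol y) (g n)) : ℂ)‖ := fun n => by
    by_cases h : S / 2 ≤ lqEnergy q (besselMap hs.le (g n))
    · obtain ⟨y, hy⟩ := hnv (g n) (hg n) h
      exact ⟨y, fun _ => hy⟩
    · exact ⟨0, fun h' => absurd h' h⟩
  choose y hy using hy
  have hlim : Tendsto (fun n => lqEnergy q (besselMap hs.le (g n))) atTop (𝓝 S) := by
    simp_rw [hge]
    exact he
  refine ⟨fun n => mulOp (isSymbol_charSymbol (y n)) (g n), φ, δ, hδ, fun n => ?_, ?_, ?_⟩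
  · rw [norm_mulOp_eq _ (norm_charSymbol _), hg]
  · exact hlim.congr fun n => (lqEnergy_besselMap_mulOp_charSymbol hs _ _).symm
  · filter_upwards [(tendsto_order.1 hlim).1 _ (ENNReal.half_lt_self hSpos hfin.ne)] with n hn
    exact hy n hn.le

theorem exists_optimizer (hs : 0 < s) (hq : 2 < q)
    (hgap : (d : ℝ) * (1 / 2 - 1 / q) < s) (hfin : bestConst d s q < ∞) :
    ∃ F : L2 d, ‖F‖ = 1 ∧ lqEnergy q (besselMap hs.le F) = bestConst d s q := by
  obtain ⟨f, φ, δ, hδ, hf, hlim, hnv⟩ := exists_maximizing_seq hs hq hgap hfin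
  -- This gives the separability of `L²` required for extracting a weakly convergent subsequence.
  have : Fact ((2 : ℝ≥0∞) ≠ ∞) := ⟨by norm_num⟩
  obtain ⟨F, ns, hns, hweak⟩ := exists_weakTendsto_subseq f (fun n => (hf n).le)
  obtain ⟨ms, hms, hae⟩ := hweak.exists_ae_tendsto hs (fun n => (hf (ns n)).le)
  -- The lower bound `δ` on the pairing with the fixed vector `φ` survives the weak limit.
  have hF : F ≠ 0 := by
    rintro rfl
    have h1 := (hweak φ).norm
    rw [inner_zero_right, norm_zero] at h1
    exact hδ.not_ge (ge_of_tendsto h1 (hns.tendsto_atTop.eventually hnv))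
  exact ⟨F, norm_eq_one_of_weakTendsto hs hq hfin (fun n => hf (ns (ms n)))
    (fun g => (hweak g).comp hms.tendsto_atTop) hF
    (hlim.comp (hns.tendsto_atTop.comp hms.tendsto_atTop)) hae⟩

end GNS

end

theorem mainTheorem8 (d : ℕ) (s q : ℝ) (hs : 0 < s) (hsd : s < (d : ℝ) / 2)
    (hq : 2 < q) (hq' : q < 2 * (d : ℝ) / ((d : ℝ) - 2 * s)) :
    GNS.bestConst d s q < ∞ ∧
      ∃ u : GNS.L2 d, GNS.MemHs s u ∧ GNS.hsNorm s u = 1 ∧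
        GNS.lqEnergy q u = GNS.bestConst d s q := by
  have hgap := GNS.subcritical_gap hsd hq hq'
  have hfin := GNS.bestConst_lt_top hs hq hgap
  obtain ⟨F, hF, hE⟩ := GNS.exists_optimizer hs hq hgap hfin
  refine ⟨hfin, GNS.besselMap hs.le F, GNS.memHs_besselMap hs.le F, ?_, hE⟩
  rw [GNS.hsNorm_besselMap, ← ofReal_norm, hF, ENNReal.ofReal_one]
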